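/- **Setting.** Let $g>0$ and let $d$ be the space dimension. For a shallow water state $u=(h,q)\in\mathbb R\times\mathbb R^d$ put $v(u)=q/h$ (with $v=0$ for the dry state $u=0$), and let $$E_{\rm flat}(u)=\tfrac12 g h^2+\tfrac12 h\|v\|^2,\qquad F_{\rm flat}(u)=v\,\big(E_{\rm flat}(u)+\tfrac12 g h^2\big).$$ Let $\mathcal V=\{1,\dots,I\}$ be the set of degrees of freedom, with stencils $\mathcal I(i)\ni i$, $\mathcal I(i)\subseteq\mathcal V$, masses $m_i>0$ and vectors $c_{ij}\in\mathbb R^d$ such that $c_{ij}=0$ for $j\notin\mathcal I(i)$ and $\sum_{j\in\mathcal I(i)}c_{ij}=0$. Let $Z_i\in\mathbb R$ be the discrete bathymetry and $U_i=(H_i,Q_i)$, $i\in\mathcal V$, the states at the current time, with $H_i>0$. With parameters $\varepsilon,h_{\max}$ set $$V_i=\frac{2H_i}{H_i^2+\max(H_i,\varepsilon h_{\max})^2}\,Q_i ,$$ and assume $H_i\ge\varepsilon h_{\max}$ for all $i$ (the regularization is not active, so $V_i=Q_i/H_i$). Set $$H_i^{j,*}=\max\big(0,\,H_i+Z_i-\max(Z_i,Z_j)\big),\qquad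 U_i^{j,*}=\big(H_i^{j,*},\,H_i^{j,*}V_i\big).$$ For $i\ne j$ with $c_{ij}\neq 0$ let $\lambda_{ij}$ be any upper bound on the maximum wave speed of the (exact) solution of the Riemann problem with left state $U_i^{j,*}$, right state $U_j^{i,*}$ and the shallow water flux in the direction $n_{ij}=c_{ij}/\|c_{ij}\|$. Let $d_{ij}=\max(\lambda_{ij}\|c_{ij}\|,\lambda_{ji}\|c_{ji}\|)$ for $j\ne i$ (a term with $c_{ij}=0$ or $c_{ji}=0$ counts as $0$) and $d_{ii}=-\sum_{j\in\mathcal I(i)\setminus\{i\}}d_{ij}$. For a time step $\tau>0$ the low-order update $U_i^{L}=U_i^{L}(\tau)$ is given by $\frac{m_i}{\tau}(U_i^{L}-U_i)=\sum_{j\in\mathcal I(i)}F_{ij}$ with $$F_{ij}=-(V_j\cdot c_{ij})U_j^{i,*}-(V_i\cdot c_{ij})U_i^{j,*}+d_{ij}\big(U_j^{i,*}-U_i^{j,*}\big)-\Big(0,\;g\big(\tfrac12(H_j^{i,*})^2-\tfrac12(H_i^{j,*})^2+H_i^2\big)c_{ij}\Big).$$ Let $B_i=\sum_{j\in\mathcal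 I(i)}-2\,(d_{ij}+V_i\cdot c_{ij})\,(U_i^{j,*}-U_i)$. The CFL condition is $\tau\le\min_{k\in\mathcal V}\frac{m_k}{2|d_{kk}|}$ (an index with $d_{kk}=0$ imposes no restriction). **Proposition (entropy inequality).** Let $i\in\mathcal V$, and denote by $(\ast)_{C}$ the inequality $$\frac{m_i}{\tau}\big(E_{\rm flat}(U_i^{L})-E_{\rm flat}(U_i)\big)+\sum_{j\in\mathcal I(i)}\Big\{\big(F_{\rm flat}(U_j^{i,*})-F_{\rm flat}(U_i^{j,*})\big)\cdot c_{ij}-d_{ij}\big(E_{\rm flat}(U_j^{i,*})-E_{\rm flat}(U_i^{j,*})\big)\Big\}\le\nabla_uE_{\rm flat}(U_i)\cdot B_i+C\tau .$$ 1. For every $\delta>0$ there is a constant $C$, independent of $\tau$, such that $(\ast)_{C}$ holds for all $\tau>0$ that satisfy the CFL condition and for which the updated depth is at least $\delta$. (For $\delta<H_i$ this includes all sufficiently small $\tau$.) 2. If $d_{ij}+V_i\cdot c_{ij}\ge0$ for all $j\in\mathcal I(i)$ with $H_i^{j,*}=0$, then there is a constant $C$, independent of $\tau$, such that for all $\tau>0$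 that satisfy the CFL condition, $U_i^{L}$ has positive depth and $(\ast)_{C}$ holds. 3. If the topography is flat around $i$, i.e. $Z_j=Z_i$ for all $j\in\mathcal I(i)$, then for all $\tau>0$ that satisfy the CFL condition, $U_i^{L}$ has positive depth and $$\frac{m_i}{\tau}\big(E_{\rm flat}(U_i^{L})-E_{\rm flat}(U_i)\big)+\sum_{j\in\mathcal I(i)}\Big\{\big(F_{\rm flat}(U_j)-F_{\rm flat}(U_i)\big)\cdot c_{ij}-d_{ij}\big(E_{\rm flat}(U_j)-E_{\rm flat}(U_i)\big)\Big\}\le0 .$$ -/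

import Mathlib

noncomputable section

namespace ShallowWater

/-- A conserved state `u = (h, q)`: water depth and discharge. -/
abbrev State (d : ℕ) : Type := ℝ × EuclideanSpace ℝ (Fin d)

/-- The invariant set of states with positive water depth. -/
def admissible (d : ℕ) : Set (State d) := {u | 0 < u.1}

/-- The velocity `v = q / h` (equal to `0` in the dry state `h = 0`, `q = 0`). -/
def velocity {d : ℕ} (u : State d) : EuclideanSpace ℝ (Fin d) := u.1⁻¹ • u.2

/-- The flat-topography entropy `½ g h² + ½ h ‖v‖²`. -/
def Eflat {d : ℕ} (g : ℝ) (u : State d) : ℝ :=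
  1 / 2 * g * u.1 ^ 2 + 1 / 2 * u.1 * ‖velocity u‖ ^ 2

/-- The flat-topography entropy flux `v (E_flat(u) + ½ g h²)`. -/
def Fflat {d : ℕ} (g : ℝ) (u : State d) : EuclideanSpace ℝ (Fin d) :=
  (Eflat g u + 1 / 2 * g * u.1 ^ 2) • velocity u

/-! ### The largest wave speed in a Riemann problem

The one-dimensional Riemann problem for the shallow water flux in a unit direction `n` has data
`(hL, vL)` and `(hR, vR)`, with `vL`, `vR` the velocity components along `n`; the tangential
velocity is only carried along by the middle wave and has no effect on the two outer waves. -/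

/-- The velocity change across the outer wave that connects depth `h₀` to depth `h`:
a rarefaction when `h ≤ h₀`, a shock when `h > h₀`. -/
def waveCurve (g h₀ h : ℝ) : ℝ :=
  if h ≤ h₀ then 2 * (√(g * h) - √(g * h₀))
  else (h - h₀) * √(g * (h + h₀) / (2 * h * h₀))

/-- The depth `h*` between the two outer waves, for wet data. The function
`h ↦ waveCurve g hL h + waveCurve g hR h + vR - vL` is strictly increasing and continuous on
`[0, ∞)` and unbounded; `h*` is its zero, or `0` (a vacuum forms) if it is nonnegative at `0`. -/
def middleDepth (g hL vL hR vR : ℝ) : ℝ :=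
  sInf {h : ℝ | 0 ≤ h ∧ 0 ≤ waveCurve g hL h + waveCurve g hR h + vR - vL}

/-- The speed, relative to the fluid with depth `h₀`, of the outer edge of the wave between `h₀`
and the middle depth `h`: `√(g h₀)` for a rarefaction, the shock speed `√(g h (h + h₀) / (2 h₀))`
for a shock. -/
def edgeSpeed (g h₀ h : ℝ) : ℝ :=
  if h ≤ h₀ then √(g * h₀) else √(g * h * (h + h₀) / (2 * h₀))

/-- The speed of the leftmost edge of the Riemann fan. If exactly one side is dry, the fan is a
single rarefaction into vacuum; if both are dry there are no waves. -/
def leftSpeed (g hL vL hR vR : ℝ) : ℝ :=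
  if 0 < hL then
    if 0 < hR then vL - edgeSpeed g hL (middleDepth g hL vL hR vR)
    else vL - √(g * hL)
  else if 0 < hR then vR - 2 * √(g * hR)
  else 0

/-- The speed of the rightmost edge of the Riemann fan. -/
def rightSpeed (g hL vL hR vR : ℝ) : ℝ :=
  if 0 < hR then
    if 0 < hL then vR + edgeSpeed g hR (middleDepth g hL vL hR vR)
    else vR + √(g * hR)
  else if 0 < hL then vL + 2 * √(g * hL)
  else 0

/-- The maximum wave speed (in absolute value) of the Riemann problem with left state `uL`, right
state `uR` and the shallow water flux in the unit direction `n`. -/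
def maxWaveSpeed {d : ℕ} (g : ℝ) (uL uR : State d) (n : EuclideanSpace ℝ (Fin d)) : ℝ :=
  max |leftSpeed g uL.1 (inner ℝ (velocity uL) n) uR.1 (inner ℝ (velocity uR) n)|
    |rightSpeed g uL.1 (inner ℝ (velocity uL) n) uR.1 (inner ℝ (velocity uR) n)|

/-! ### The discretization and the low-order scheme -/

/-- The part of the spatial discretization that enters the low-order scheme: stencils `I(i)`,
lumped masses `m_i` and the discrete gradient vectors `c_ij`. -/
structure Discretization (d N : ℕ) where
  stencil : Fin N → Finset (Fin N)
  mem_stencil : ∀ i, i ∈ stencil i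
  m : Fin N → ℝ
  m_pos : ∀ i, 0 < m i
  c : Fin N → Fin N → EuclideanSpace ℝ (Fin d)
  c_eq_zero : ∀ i j, j ∉ stencil i → c i j = 0
  sum_c : ∀ i, ∑ j ∈ stencil i, c i j = 0

/-- The regularized velocity `V = 2 H / (H² + max(H, ε h_max)²) Q`. -/
def regVelocity {d : ℕ} (ε hmax : ℝ) (u : State d) : EuclideanSpace ℝ (Fin d) :=
  (2 * u.1 / (u.1 ^ 2 + max u.1 (ε * hmax) ^ 2)) • u.2

/-- The data of one time step: gravity, regularization parameters, discretization, bathymetry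
`Z_i`, the states `U_i` at the current time, and the numbers `lam i j`, which are used as bounds on
the wave speed in the local Riemann problem of the pair `(i, j)`. -/
structure Step (d N : ℕ) where
  g : ℝ
  ε : ℝ
  hmax : ℝ
  disc : Discretization d N
  Z : Fin N → ℝ
  U : Fin N → State d
  lam : Fin N → Fin N → ℝ

namespace Step

variable {d N : ℕ} (S : Step d N)

/-- The velocity `V_i` of the current state. -/
def V (i : Fin N) : EuclideanSpace ℝ (Fin d) := regVelocity S.ε S.hmax (S.U i)

/-- The reconstructed depth `H_i^{j,*} = max(0, H_i + Z_i - max(Z_i, Z_j))`. -/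
def Hstar (i j : Fin N) : ℝ := max 0 ((S.U i).1 + S.Z i - max (S.Z i) (S.Z j))

/-- The hydrostatic reconstruction `U_i^{j,*} = (H_i^{j,*}, H_i^{j,*} V_i)`. -/
def Ustar (i j : Fin N) : State d := (S.Hstar i j, S.Hstar i j • S.V i)

/-- The direction `n_ij = c_ij / ‖c_ij‖`. -/
def normal (i j : Fin N) : EuclideanSpace ℝ (Fin d) := ‖S.disc.c i j‖⁻¹ • S.disc.c i j

/-- `lam i j` is a guaranteed upper bound on the maximum wave speed of the Riemann problem with
left state `U_i^{j,*}`, right state `U_j^{i,*}` and direction `n_ij`, whenever `c_ij ≠ 0` (else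
there is no direction, and `lam i j` only enters multiplied by `‖c_ij‖ = 0`). -/
def WaveSpeedBound : Prop :=
  ∀ i j, i ≠ j → S.disc.c i j ≠ 0 →
    maxWaveSpeed S.g (S.Ustar i j) (S.Ustar j i) (S.normal i j) ≤ S.lam i j

/-- The graph viscosity for a pair of distinct indices. -/
def viscOff (i j : Fin N) : ℝ :=
  max (S.lam i j * ‖S.disc.c i j‖) (S.lam j i * ‖S.disc.c j i‖)

/-- The graph viscosity `d_ij`, with `d_ii = -∑_{j ∈ I(i) \ {i}} d_ij`. -/
def visc (i j : Fin N) : ℝ :=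
  if i = j then -∑ k ∈ (S.disc.stencil i).erase i, S.viscOff i k else S.viscOff i j

/-- The low-order flux `F_ij`; note `(U ⊗ V) c = (V · c) U`. -/
def lowFlux (i j : Fin N) : State d :=
  -(inner ℝ (S.V j) (S.disc.c i j) • S.Ustar j i + inner ℝ (S.V i) (S.disc.c i j) • S.Ustar i j)
    + S.visc i j • (S.Ustar j i - S.Ustar i j)
    - ((0 : ℝ), (S.g * (1 / 2 * S.Hstar j i ^ 2 - 1 / 2 * S.Hstar i j ^ 2 + (S.U i).1 ^ 2)) •
        S.disc.c i j)

/-- The low-order update with time step `τ`, i.e. the solution of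
`(m_i / τ) (U_i^{L,n+1} - U_i^n) = ∑_{j ∈ I(i)} F_ij`. -/
def update (τ : ℝ) (i : Fin N) : State d :=
  S.U i + (τ / S.disc.m i) • ∑ j ∈ S.disc.stencil i, S.lowFlux i j

/-- The affine shift `B_i = ∑_{j ∈ I(i)} -2 (d_ij + V_i · c_ij) (U_i^{j,*} - U_i)`. -/
def shift (i : Fin N) : State d :=
  ∑ j ∈ S.disc.stencil i,
    (-2 * (S.visc i j + inner ℝ (S.V i) (S.disc.c i j))) • (S.Ustar i j - S.U i)

/-- The time step restriction `τ ≤ min_i m_i / (2 |d_ii|)`, written without the division so that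
an index with `d_ii = 0` imposes no restriction. -/
def CFL (τ : ℝ) : Prop := ∀ i, τ * (2 * |S.visc i i|) ≤ S.disc.m i

/-- The left-hand side of the discrete entropy inequality with reconstructed states. -/
def entropyBalance (τ : ℝ) (i : Fin N) : ℝ :=
  S.disc.m i / τ * (Eflat S.g (S.update τ i) - Eflat S.g (S.U i)) +
    ∑ j ∈ S.disc.stencil i,
      (inner ℝ (Fflat S.g (S.Ustar j i) - Fflat S.g (S.Ustar i j)) (S.disc.c i j) -
        S.visc i j * (Eflat S.g (S.Ustar j i) - Eflat S.g (S.Ustar i j)))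

/-- The left-hand side of the discrete entropy inequality without reconstruction. -/
def entropyBalanceFlat (τ : ℝ) (i : Fin N) : ℝ :=
  S.disc.m i / τ * (Eflat S.g (S.update τ i) - Eflat S.g (S.U i)) +
    ∑ j ∈ S.disc.stencil i,
      (inner ℝ (Fflat S.g (S.U j) - Fflat S.g (S.U i)) (S.disc.c i j) -
        S.visc i j * (Eflat S.g (S.U j) - Eflat S.g (S.U i)))

end Step

end ShallowWater

end

/-! ### Entropy budget of a single outer wave. -/

namespace ShallowWater

/-! Everything is measured relative to the updated state `w`. The Bregman divergence of the entropy
`E` turns the time difference into an exact identity: (m_i/τ)(E(w) - E(U_i)) is (m_i/τ)∇E(w)(w -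
U_i) minus m_i/τ times the relative entropy of U_i with respect to `w`. Up to terms cancelling
because the c_ij sum to zero, the fluxes split into bar fluxes plus the shift B_i (`sum_lowFlux`).
The bar fluxes, tested with ∇E(w) and combined with the entropy flux and viscosity terms, cost at
most 2|d_ii| times that same relative entropy (`barFlux_entropy_le`), which the CFL condition
absorbs. What remains is ∇E(w)·B_i (`entropyBalance_le`).

The cost estimate rests on one fact per Riemann problem: the relative entropy in the fan, computed
as initial content plus net inflow, is nonnegative (`riemann_relEntropy_ineq`). It is split at the
contact, so each outer wave reduces to a polynomial inequality (`wave_entropy_ineq`), and the fan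
need not be integrated.

Finally B_i = b(1, V_i), so replacing ∇E(w) by ∇E(U_i) costs b g times the depth change, which is
linear in τ, and -b/2 times the squared velocity change. The latter is O(τ) while the depth stays
above δ, has a good sign for b ≥ 0, and vanishes for flat topography, where b = 0. -/

theorem rarefaction_entropy_ineq {c₀ c : ℝ} (hc₀ : 0 < c₀) (hc : 0 ≤ c) (hcc : c ≤ c₀) (α V : ℝ) :
    0 ≤ c₀ * ((c₀ ^ 2 - α) ^ 2 + c₀ ^ 2 * V ^ 2) + V * (c₀ ^ 4 - c ^ 4)
      + 2 * (c - c₀) * (c ^ 4 - α ^ 2) := by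
  obtain ⟨y, rfl⟩ : ∃ y, c₀ = c + y := ⟨c₀ - c, by ring⟩
  have hy : 0 ≤ y := by linarith
  have key : 0 ≤ 4 * (c + y) ^ 3 * ((c + y) ^ 5 * (c + 3 * y) - 2 * y * c ^ 4 * (c + 3 * y)
      - (c + y) ^ 6) - (c + 3 * y) * ((c + y) ^ 4 - c ^ 4) ^ 2 := by
    ring_nf
    positivity
  have h3 : 0 < c + 3 * y := by linarith
  have hpos : 0 < 4 * (c + y) ^ 3 * (c + 3 * y) := by positivity
  refine nonneg_of_mul_nonneg_right ?_ hpos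
  -- Squares are completed in V and in α; the remainder, `key`, has only nonnegative coefficients in
  -- c and the drop y = c₀ - c.
  have e : 4 * (c + y) ^ 3 * (c + 3 * y) * ((c + y) * (((c + y) ^ 2 - α) ^ 2 + (c + y) ^ 2 * V ^ 2)
      + V * ((c + y) ^ 4 - c ^ 4) + 2 * (c - (c + y)) * (c ^ 4 - α ^ 2)) =
      (c + 3 * y) * (2 * (c + y) ^ 3 * V + ((c + y) ^ 4 - c ^ 4)) ^ 2
      + 4 * (c + y) ^ 3 * ((c + 3 * y) * α - (c + y) ^ 3) ^ 2
      + (4 * (c + y) ^ 3 * ((c + y) ^ 5 * (c + 3 * y) - 2 * y * c ^ 4 * (c + 3 * y)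
      - (c + y) ^ 6) - (c + 3 * y) * ((c + y) ^ 4 - c ^ 4) ^ 2) := by ring
  rw [e]
  positivity

/-- Here e is the shock speed relative to the outer fluid, and e (h - h₀) / h is the velocity jump.
After completing squares, both squares vanish exactly when the reference state is the middle state;
what is left is the shock dissipation, cubic in the strength h - h₀. -/
theorem shock_entropy_ineq {g h₀ h e : ℝ} (hg : 0 < g) (hh₀ : 0 < h₀) (hh : h₀ < h) (he : 0 < e)
    (hsq : 2 * h₀ * e ^ 2 = g * h * (h + h₀)) (a V : ℝ) :
    0 ≤ e * (1 / 2 * g * (h₀ - a) ^ 2 + 1 / 2 * h₀ * V ^ 2) + V * (1 / 2 * g * (h₀ ^ 2 - h ^ 2))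
      + e * (h - h₀) / h * (1 / 2 * g * (h ^ 2 - a ^ 2)) := by
  have hpos : 0 < h := hh₀.trans hh
  obtain ⟨y, rfl⟩ : ∃ y, h = h₀ + y := ⟨h - h₀, by ring⟩
  have hy : 0 < y := by linarith
  have h8 : 0 < 8 * e * h₀ * (h₀ + y) := by positivity
  refine nonneg_of_mul_nonneg_right ?_ h8
  have e1 : 8 * e * h₀ * (h₀ + y) * (e * (1 / 2 * g * (h₀ - a) ^ 2 + 1 / 2 * h₀ * V ^ 2)
      + V * (1 / 2 * g * (h₀ ^ 2 - (h₀ + y) ^ 2))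
      + e * (h₀ + y - h₀) / (h₀ + y) * (1 / 2 * g * ((h₀ + y) ^ 2 - a ^ 2))) =
      (h₀ + y) * (2 * e * h₀ * V - g * y * (2 * h₀ + y)) ^ 2
      + 4 * e ^ 2 * h₀ ^ 2 * g * (a - (h₀ + y)) ^ 2
      + (4 * e ^ 2 * h₀ * g * (y ^ 2 * (h₀ + y)) - (h₀ + y) * (g * y * (2 * h₀ + y)) ^ 2) := by
    field_simp
    ring
  rw [e1]
  have e2 : 4 * e ^ 2 * h₀ * g * (y ^ 2 * (h₀ + y)) - (h₀ + y) * (g * y * (2 * h₀ + y)) ^ 2 =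
      g ^ 2 * y ^ 3 * (h₀ + y) * (2 * h₀ + y) := by
    linear_combination 2 * g * (y ^ 2 * (h₀ + y)) * hsq
  rw [e2]
  positivity

/-- For rarefactions, passing to c = √(g h) and α = g a and scaling by 2g makes the expression
polynomial. -/
theorem wave_entropy_ineq {g h₀ h : ℝ} (hg : 0 < g) (hh₀ : 0 < h₀) (hh : 0 ≤ h) (a V : ℝ) :
    0 ≤ edgeSpeed g h₀ h * (1 / 2 * g * (h₀ - a) ^ 2 + 1 / 2 * h₀ * V ^ 2)
      + V * (1 / 2 * g * (h₀ ^ 2 - h ^ 2)) + waveCurve g h₀ h * (1 / 2 * g * (h ^ 2 - a ^ 2)) := by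
  unfold edgeSpeed waveCurve
  split_ifs with hle
  · have s0 : √(g * h₀) ^ 2 = g * h₀ := Real.sq_sqrt (by positivity)
    have s1 : √(g * h) ^ 2 = g * h := Real.sq_sqrt (by positivity)
    have key := rarefaction_entropy_ineq (Real.sqrt_pos.2 (mul_pos hg hh₀))
      (Real.sqrt_nonneg (g * h)) (Real.sqrt_le_sqrt (by gcongr)) (g * a) V
    have f0 : √(g * h₀) ^ 4 = (g * h₀) ^ 2 := by
      linear_combination (√(g * h₀) ^ 2 + g * h₀) * s0
    have f1 : √(g * h) ^ 4 = (g * h) ^ 2 := by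
      linear_combination (√(g * h) ^ 2 + g * h) * s1
    rw [f0, f1, s0] at key
    refine nonneg_of_mul_nonneg_right ?_ (by positivity : 0 < 2 * g)
    exact key.trans_eq (by ring)
  · push Not at hle
    have hp : 0 < h := hh₀.trans hle
    have harg : 0 < g * h * (h + h₀) / (2 * h₀) := by positivity
    have hw : √(g * (h + h₀) / (2 * h * h₀)) = √(g * h * (h + h₀) / (2 * h₀)) / h := by
      rw [show g * (h + h₀) / (2 * h * h₀) = g * h * (h + h₀) / (2 * h₀) / h ^ 2 by field_simp,
        Real.sqrt_div harg.le, Real.sqrt_sq hp.le]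
    have key := shock_entropy_ineq hg hh₀ hle (Real.sqrt_pos.2 harg)
      (by rw [Real.sq_sqrt harg.le]; field_simp) a V
    rw [hw]
    exact key.trans_eq (by ring)

/-! ### The wave curve and the middle depth. -/

theorem continuous_waveCurve {g h₀ : ℝ} (hh₀ : 0 < h₀) : Continuous (waveCurve g h₀) := by
  -- The `max` leaves the shock branch unchanged where it is used and keeps its denominator away
  -- from zero everywhere.
  have hc : Continuous fun h => if h ≤ h₀ then 2 * (√(g * h) - √(g * h₀))
      else (h - h₀) * √(g * (max h h₀ + h₀) / (2 * max h h₀ * h₀)) := by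
    refine Continuous.if_le (by fun_prop) ?_ continuous_id continuous_const ?_
    · refine (continuous_id.sub continuous_const).mul (Real.continuous_sqrt.comp ?_)
      refine Continuous.div (by fun_prop) (by fun_prop) fun h => ?_
      have : 0 < max h h₀ := lt_max_of_lt_right hh₀
      positivity
    · rintro h rfl
      simp
  convert hc using 2 with h
  unfold waveCurve
  split_ifs with hle
  · rfl
  · rw [max_eq_left (le_of_not_ge hle)]

theorem neg_two_sqrt_le_waveCurve {g h₀ h : ℝ} : -(2 * √(g * h₀)) ≤ waveCurve g h₀ h := by
  unfold waveCurve
  split_ifs with hle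
  · linarith [Real.sqrt_nonneg (g * h)]
  · push Not at hle
    have := mul_nonneg (sub_nonneg.2 hle.le) (Real.sqrt_nonneg (g * (h + h₀) / (2 * h * h₀)))
    linarith [Real.sqrt_nonneg (g * h₀)]

theorem mul_sqrt_le_waveCurve {g h₀ h : ℝ} (hg : 0 < g) (hh₀ : 0 < h₀) (hh : h₀ < h) :
    (h - h₀) * √(g / (2 * h₀)) ≤ waveCurve g h₀ h := by
  have hp : 0 < h := hh₀.trans hh
  rw [waveCurve, if_neg hh.not_ge]
  refine mul_le_mul_of_nonneg_left (Real.sqrt_le_sqrt ?_) (by linarith)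
  rw [div_le_div_iff₀ (by positivity) (by positivity)]
  nlinarith [mul_pos hg (mul_pos hh₀ hh₀)]

/-- The defining property of the middle depth: it solves the depth equation, or a vacuum forms. -/
theorem middleDepth_spec {g hL hR : ℝ} (hg : 0 < g) (hhL : 0 < hL) (hhR : 0 < hR) (vL vR : ℝ) :
    0 ≤ middleDepth g hL vL hR vR ∧
      (waveCurve g hL (middleDepth g hL vL hR vR) + waveCurve g hR (middleDepth g hL vL hR vR)
        + vR - vL = 0 ∨
      middleDepth g hL vL hR vR = 0 ∧ 0 ≤ waveCurve g hL 0 + waveCurve g hR 0 + vR - vL) := by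
  set φ : ℝ → ℝ := fun h => waveCurve g hL h + waveCurve g hR h + vR - vL with hφ
  have hcont : Continuous φ :=
    (((continuous_waveCurve hhL).add (continuous_waveCurve hhR)).add
      continuous_const).sub continuous_const
  set A : Set ℝ := {h | 0 ≤ h ∧ 0 ≤ φ h} with hA
  have hmid : middleDepth g hL vL hR vR = sInf A := rfl
  have hbdd : BddBelow A := ⟨0, fun h hh => hh.1⟩
  have hclosed : IsClosed A :=
    (isClosed_le continuous_const continuous_id).inter (isClosed_le continuous_const hcont)
  have hne : A.Nonempty := by
    have hs : 0 < √(g / (2 * hL)) := Real.sqrt_pos.2 (by positivity)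
    -- The linear growth of the left shock branch must beat the velocity difference and the lowest
    -- possible value of the right curve; the 1 only makes M positive.
    set M : ℝ := (|vL - vR| + 2 * √(g * hR) + 1) / √(g / (2 * hL))
    have hM : 0 < M := by positivity
    refine ⟨hL + M, by positivity, ?_⟩
    have h1 := mul_sqrt_le_waveCurve hg hhL (by linarith : hL < hL + M)
    have h2 : (hL + M - hL) * √(g / (2 * hL)) = |vL - vR| + 2 * √(g * hR) + 1 := by
      rw [add_sub_cancel_left, div_mul_cancel₀ _ hs.ne']
    have h3 := neg_two_sqrt_le_waveCurve (g := g) (h₀ := hR) (h := hL + M)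
    have h4 := le_abs_self (vL - vR)
    simp only [hφ]
    linarith
  have hmem : sInf A ∈ A := hclosed.csInf_mem hne hbdd
  rw [hmid]
  refine ⟨hmem.1, ?_⟩
  by_cases h0 : 0 ≤ φ 0
  · exact Or.inr ⟨le_antisymm (csInf_le hbdd ⟨le_rfl, h0⟩) hmem.1, h0⟩
  · left
    push Not at h0
    by_contra hne0
    have hpos : 0 < φ (sInf A) := lt_of_le_of_ne hmem.2 (Ne.symm hne0)
    -- A sign change on the open interval would give a zero below the infimum, so monotonicity is
    -- not needed.
    obtain ⟨x, hx, hx0⟩ := intermediate_value_Ioo hmem.1 hcont.continuousOn ⟨h0, hpos⟩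
    exact absurd (csInf_le hbdd (show x ∈ A from ⟨hx.1.le, hx0.ge⟩)) (not_le.2 hx.2)

end ShallowWater

/-! ### Relative entropy in the Riemann problem. -/

namespace ShallowWater

variable {d : ℕ}

theorem edgeSpeed_pos {g h₀ : ℝ} (hg : 0 < g) (hh₀ : 0 < h₀) (h : ℝ) : 0 < edgeSpeed g h₀ h := by
  unfold edgeSpeed
  split_ifs with hle
  · positivity
  · have : 0 < h := hh₀.trans (not_le.1 hle)
    positivity

/-- The relative entropy of the state with depth `h` and velocity `v` with respect to the state
with depth `a` and velocity `w`. -/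
noncomputable def relEntropy (g a : ℝ) (w : EuclideanSpace ℝ (Fin d)) (h : ℝ) (v : EuclideanSpace ℝ (Fin d)) :
    ℝ :=
  1 / 2 * g * (h - a) ^ 2 + 1 / 2 * h * ‖v - w‖ ^ 2

/-- The flux of the relative entropy in the direction `n`, up to a constant. -/
noncomputable def relFlux (g a : ℝ) (w : EuclideanSpace ℝ (Fin d)) (h : ℝ) (v n : EuclideanSpace ℝ (Fin d)) :
    ℝ :=
  inner ℝ v n * (g * h ^ 2 - g * a * h + 1 / 2 * h * ‖v - w‖ ^ 2) - 1 / 2 * g * h ^ 2 * inner ℝ w n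

theorem relEntropy_nonneg {g a h : ℝ} (hg : 0 < g) (hh : 0 ≤ h)
    (w v : EuclideanSpace ℝ (Fin d)) : 0 ≤ relEntropy g a w h v := by
  unfold relEntropy
  positivity

theorem relFlux_smul (g a h r : ℝ) (w v n : EuclideanSpace ℝ (Fin d)) :
    relFlux g a w h v (r • n) = r * relFlux g a w h v n := by
  simp only [relFlux, inner_smul_right]
  ring

theorem relFlux_neg (g a h : ℝ) (w v n : EuclideanSpace ℝ (Fin d)) :
    relFlux g a w h v (-n) = -relFlux g a w h v n := by
  simp only [relFlux, inner_neg_right]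
  ring

/-- The left-hand side is the relative entropy flux across the contact path, which moves with
velocity v·n - `waveCurve g h₀ h`; the kinetic part drops out there. The right-hand side is initial
content plus inflow on the outer side. Tangential velocity enters only through Cauchy-Schwarz. -/
theorem relEntropy_wave_ineq {g a h₀ h lam : ℝ} (hg : 0 < g) (hh₀ : 0 < h₀) (hh : 0 ≤ h)
    (w v n : EuclideanSpace ℝ (Fin d)) (hn : ‖n‖ = 1)
    (hlam : edgeSpeed g h₀ h ≤ lam + inner ℝ v n) :
    (inner ℝ v n - waveCurve g h₀ h) * (1 / 2 * g * (h ^ 2 - a ^ 2))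
      - 1 / 2 * g * h ^ 2 * inner ℝ w n ≤ lam * relEntropy g a w h₀ v + relFlux g a w h₀ v n := by
  have key := wave_entropy_ineq hg hh₀ hh a (inner ℝ v n - inner ℝ w n)
  have hcs : (inner ℝ v n - inner ℝ w n) ^ 2 ≤ ‖v - w‖ ^ 2 := by
    rw [← inner_sub_left, sq_le_sq, abs_norm]
    simpa [hn] using abs_real_inner_le_norm (v - w) n
  have h1 := mul_le_mul_of_nonneg_right hlam (relEntropy_nonneg (a := a) hg hh₀.le w v)
  have h2 := mul_le_mul_of_nonneg_left hcs
    (by have := edgeSpeed_pos hg hh₀ h; positivity : 0 ≤ edgeSpeed g h₀ h * (1 / 2 * h₀))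
  unfold relFlux
  unfold relEntropy at h1 ⊢
  linarith

theorem velocity_mk_smul {h : ℝ} (hh : h ≠ 0) (v : EuclideanSpace ℝ (Fin d)) :
    velocity ((h, h • v) : State d) = v := by
  simp [velocity, smul_smul, hh]

theorem maxWaveSpeed_nonneg (g : ℝ) (uL uR : State d) (n : EuclideanSpace ℝ (Fin d)) :
    0 ≤ maxWaveSpeed g uL uR n :=
  (abs_nonneg _).trans (le_max_left _ _)

/-- The left edge moves strictly slower than the left fluid, and its speed is at least -lam. -/
theorem pos_add_of_maxWaveSpeed_le {g hL lam : ℝ} (hg : 0 < g) (hhL : 0 < hL)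
    {vL n : EuclideanSpace ℝ (Fin d)} {uR : State d}
    (hlam : maxWaveSpeed g (hL, hL • vL) uR n ≤ lam) : 0 < lam + inner ℝ vL n := by
  have h1 := (neg_le_abs _).trans ((le_max_left _ _).trans hlam)
  simp only [velocity_mk_smul hhL.ne', leftSpeed, if_pos hhL] at h1
  split_ifs at h1
  · linarith [edgeSpeed_pos hg hhL (middleDepth g hL (inner ℝ vL n) uR.1 (inner ℝ (velocity uR) n))]
  · linarith [Real.sqrt_pos.2 (mul_pos hg hhL)]

theorem pos_sub_of_maxWaveSpeed_le {g hR lam : ℝ} (hg : 0 < g) (hhR : 0 < hR)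
    {vR n : EuclideanSpace ℝ (Fin d)} {uL : State d}
    (hlam : maxWaveSpeed g uL (hR, hR • vR) n ≤ lam) : 0 < lam - inner ℝ vR n := by
  have h1 := (le_abs_self _).trans ((le_max_right _ _).trans hlam)
  simp only [velocity_mk_smul hhR.ne', rightSpeed, if_pos hhR] at h1
  split_ifs at h1
  · linarith [edgeSpeed_pos hg hhR (middleDepth g uL.1 (inner ℝ (velocity uL) n) hR (inner ℝ vR n))]
  · linarith [Real.sqrt_pos.2 (mul_pos hg hhR)]

/-- The entropy inequality of the average of the Riemann solution, in relative form. -/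
theorem riemann_relEntropy_ineq {g a hL hR lam : ℝ} (hg : 0 < g) (hhL : 0 ≤ hL) (hhR : 0 ≤ hR)
    (w vL vR n : EuclideanSpace ℝ (Fin d)) (hn : ‖n‖ = 1)
    (hlam : maxWaveSpeed g (hL, hL • vL) (hR, hR • vR) n ≤ lam) :
    0 ≤ lam * (relEntropy g a w hL vL + relEntropy g a w hR vR)
      - (relFlux g a w hR vR n - relFlux g a w hL vL n) := by
  have hn' : ‖-n‖ = 1 := by rw [norm_neg, hn]
  have h1 := (neg_le_abs _).trans ((le_max_left _ _).trans hlam)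
  have h2 := (le_abs_self _).trans ((le_max_right _ _).trans hlam)
  have hlam0 := (maxWaveSpeed_nonneg _ _ _ _).trans hlam
  have vac : ∀ h₀ : ℝ, 0 < h₀ → waveCurve g h₀ 0 = -(2 * √(g * h₀)) ∧
      edgeSpeed g h₀ 0 = √(g * h₀) := fun h₀ hh₀ => by
    simp [waveCurve, edgeSpeed, hh₀.le]
  have hga : 0 ≤ 1 / 2 * g * a ^ 2 := by positivity
  rcases hhL.eq_or_lt' with rfl | hL0
  · rcases hhR.eq_or_lt' with rfl | hR0
    · have e1 : ∀ v : EuclideanSpace ℝ (Fin d), 0 ≤ relEntropy g a w 0 v :=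
        relEntropy_nonneg hg le_rfl w
      have := mul_nonneg hlam0 (add_nonneg (e1 vL) (e1 vR))
      simpa [relFlux] using this
    · simp only [velocity_mk_smul hR0.ne', leftSpeed, rightSpeed, lt_irrefl, if_false,
        if_pos hR0] at h1 h2
      have key := relEntropy_wave_ineq (a := a) (lam := lam) hg hR0 le_rfl w vR (-n) hn'
        (by rw [(vac hR hR0).2, inner_neg_right]; linarith)
      rw [(vac hR hR0).1, relFlux_neg, inner_neg_right, inner_neg_right] at key
      -- Vacuum still carries relative entropy density g a² / 2; the other factor is the width of
      -- the vacuum region up to -lam.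
      have h3 := mul_le_mul_of_nonneg_right h1 hga
      simp only [relFlux, relEntropy] at key ⊢
      linarith
  · rcases hhR.eq_or_lt' with rfl | hR0
    · simp only [velocity_mk_smul hL0.ne', leftSpeed, rightSpeed, lt_irrefl, if_false,
        if_pos hL0] at h1 h2
      have key := relEntropy_wave_ineq (a := a) (lam := lam) hg hL0 le_rfl w vL n hn
        (by rw [(vac hL hL0).2]; linarith)
      rw [(vac hL hL0).1] at key
      have h3 := mul_le_mul_of_nonneg_right h2 hga
      simp only [relFlux, relEntropy] at key ⊢
      linarith
    · simp only [velocity_mk_smul hL0.ne', velocity_mk_smul hR0.ne', leftSpeed, rightSpeed,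
        if_pos hL0, if_pos hR0] at h1 h2
      obtain ⟨hm0, hm⟩ := middleDepth_spec hg hL0 hR0 (inner ℝ vL n) (inner ℝ vR n)
      set h := middleDepth g hL (inner ℝ vL n) hR (inner ℝ vR n)
      have keyL := relEntropy_wave_ineq (a := a) (lam := lam) hg hL0 hm0 w vL n hn (by linarith)
      have keyR := relEntropy_wave_ineq (a := a) (lam := lam) hg hR0 hm0 w vR (-n) hn'
        (by rw [inner_neg_right]; linarith)
      rw [relFlux_neg, inner_neg_right, inner_neg_right] at keyR
      -- Mismatch of the two contact fluxes: zero if the depth equation holds, otherwise the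
      -- relative entropy of the vacuum gap.
      have hmid : 0 ≤ (waveCurve g hL h + waveCurve g hR h + inner ℝ vR n - inner ℝ vL n)
          * (1 / 2 * g * (a ^ 2 - h ^ 2)) := by
        rcases hm with hm | ⟨hm, hvac⟩
        · rw [hm, zero_mul]
        · rw [hm]
          exact mul_nonneg hvac (by nlinarith)
      linarith

end ShallowWater

/-! ### Entropy gradient and compatibility with the physical flux. -/

namespace ShallowWater

variable {d N : ℕ}

/-- The gradient of the entropy at a state of positive depth. -/
noncomputable def gradE (g : ℝ) (w : State d) : State d →L[ℝ] ℝ :=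
  (g * w.1 - 1 / 2 * ‖velocity w‖ ^ 2) • ContinuousLinearMap.fst ℝ ℝ (EuclideanSpace ℝ (Fin d))
    + (innerSL ℝ (velocity w)).comp (ContinuousLinearMap.snd ℝ ℝ (EuclideanSpace ℝ (Fin d)))

theorem gradE_apply (g : ℝ) (w u : State d) :
    gradE g w u = (g * w.1 - 1 / 2 * ‖velocity w‖ ^ 2) * u.1 + inner ℝ (velocity w) u.2 := by
  simp [gradE]

theorem hasFDerivAt_Eflat (g : ℝ) {w : State d} (hw : 0 < w.1) :
    HasFDerivAt (Eflat g) (gradE g w) w := by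
  -- This form also holds at depth zero, because the inverse of zero is zero.
  have hE : (Eflat g : State d → ℝ) = fun u =>
      1 / 2 * g * u.1 ^ 2 + 1 / 2 * (u.1⁻¹ * ‖u.2‖ ^ 2) := by
    funext u
    rw [Eflat, velocity, norm_smul, mul_pow, norm_inv, Real.norm_eq_abs, inv_pow, sq_abs]
    rcases eq_or_ne u.1 0 with h | h
    · simp [h]
    · field_simp
  have h1 : HasFDerivAt (fun u : State d => u.1) (ContinuousLinearMap.fst ℝ ℝ _) w := hasFDerivAt_fst
  have h2 : HasFDerivAt (fun u : State d => u.2) (ContinuousLinearMap.snd ℝ ℝ _) w := hasFDerivAt_snd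
  have h3 : HasFDerivAt (fun u : State d => u.1⁻¹)
      ((-(w.1 ^ 2)⁻¹) • ContinuousLinearMap.fst ℝ ℝ _) w :=
    (hasDerivAt_inv hw.ne').comp_hasFDerivAt w h1
  rw [hE]
  refine (((h1.pow 2).const_mul (1 / 2 * g)).add
    ((h3.mul h2.norm_sq).const_mul (1 / 2))).congr_fderiv ?_
  ext u
  · simp [gradE_apply, velocity, norm_smul, mul_pow]
    field_simp
    ring
  · simp [gradE_apply, velocity, inner_smul_left]
    ring

theorem Eflat_mk_smul (g h : ℝ) (v : EuclideanSpace ℝ (Fin d)) :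
    Eflat g ((h, h • v) : State d) = 1 / 2 * g * h ^ 2 + 1 / 2 * h * ‖v‖ ^ 2 := by
  rcases eq_or_ne h 0 with rfl | hh
  · simp [Eflat]
  · simp only [Eflat, velocity_mk_smul hh]

theorem inner_Fflat_mk_smul (g h : ℝ) (v c : EuclideanSpace ℝ (Fin d)) :
    inner ℝ (Fflat g ((h, h • v) : State d)) c =
      (g * h ^ 2 + 1 / 2 * h * ‖v‖ ^ 2) * inner ℝ v c := by
  rcases eq_or_ne h 0 with rfl | hh
  · simp [Fflat, Eflat]
  · rw [Fflat, Eflat_mk_smul, velocity_mk_smul hh, real_inner_smul_left]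
    ring

/-- The shallow water flux, in the direction `c`, of the state with depth `h` and velocity `v`. -/
noncomputable def physFlux (g h : ℝ) (v c : EuclideanSpace ℝ (Fin d)) : State d :=
  inner ℝ v c • (h, h • v) + ((0 : ℝ), (1 / 2 * g * h ^ 2) • c)

/-- The kinetic part of the entropy is homogeneous of degree one, so at positive depth E(w) - ∇E(w)w
is just -g/2 times the squared depth of `w`: this is the Bregman divergence. -/
theorem relEntropy_velocity (g : ℝ) (w : State d) (h : ℝ) (v : EuclideanSpace ℝ (Fin d)) :
    relEntropy g w.1 (velocity w) h v =
      Eflat g (h, h • v) - gradE g w (h, h • v) + 1 / 2 * g * w.1 ^ 2 := by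
  rw [relEntropy, Eflat_mk_smul, gradE_apply, norm_sub_sq_real, real_inner_smul_right,
    real_inner_comm]
  ring

theorem relFlux_velocity (g : ℝ) (w : State d) (h : ℝ) (v c : EuclideanSpace ℝ (Fin d)) :
    relFlux g w.1 (velocity w) h v c =
      inner ℝ (Fflat g (h, h • v)) c - gradE g w (physFlux g h v c) := by
  rw [relFlux, inner_Fflat_mk_smul, gradE_apply, norm_sub_sq_real, real_inner_comm (velocity w) v]
  simp only [physFlux, Prod.fst_add, Prod.snd_add, Prod.smul_fst, Prod.smul_snd, inner_add_right,
    real_inner_smul_right, smul_eq_mul]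
  ring

/-! ### The scheme: viscosity, flux splitting, entropy balance. -/

namespace Step

variable {S : Step d N}

theorem V_eq (hA : ∀ i, S.U i ∈ admissible d) (hreg : ∀ i, S.ε * S.hmax ≤ (S.U i).1) (i : Fin N) :
    S.U i = ((S.U i).1, (S.U i).1 • S.V i) := by
  have h : 0 < (S.U i).1 := hA i
  refine Prod.ext rfl ?_
  simp only [V, regVelocity, max_eq_left (hreg i), smul_smul]
  rw [show (S.U i).1 * (2 * (S.U i).1 / ((S.U i).1 ^ 2 + (S.U i).1 ^ 2)) = 1 by field_simp; ring,
    one_smul]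

theorem Hstar_nonneg (i j : Fin N) : 0 ≤ S.Hstar i j := le_max_left _ _

theorem Hstar_le (hA : ∀ i, S.U i ∈ admissible d) (i j : Fin N) : S.Hstar i j ≤ (S.U i).1 :=
  max_le (le_of_lt (hA i)) (by linarith [le_max_left (S.Z i) (S.Z j)])

theorem Hstar_of_Z_le (hA : ∀ i, S.U i ∈ admissible d) {i j : Fin N} (h : S.Z j ≤ S.Z i) :
    S.Hstar i j = (S.U i).1 := by
  rw [Hstar, max_eq_left h, add_sub_cancel_right, max_eq_right (le_of_lt (hA i))]

theorem Hstar_pos_or (hA : ∀ i, S.U i ∈ admissible d) (i j : Fin N) :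
    0 < S.Hstar i j ∨ 0 < S.Hstar j i := by
  rcases le_total (S.Z j) (S.Z i) with h | h
  · exact Or.inl (by rw [Hstar_of_Z_le hA h]; exact hA i)
  · exact Or.inr (by rw [Hstar_of_Z_le hA h]; exact hA j)

theorem Ustar_self (hA : ∀ i, S.U i ∈ admissible d) (hreg : ∀ i, S.ε * S.hmax ≤ (S.U i).1)
    {i j : Fin N} (h : S.Z j ≤ S.Z i) : S.Ustar i j = S.U i := by
  rw [Ustar, Hstar_of_Z_le hA h, ← V_eq hA hreg]

theorem visc_of_ne {i j : Fin N} (hij : i ≠ j) : S.visc i j = S.viscOff i j := if_neg hij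

theorem lam_mul_norm_nonneg (hlam : S.WaveSpeedBound) {i j : Fin N} (hij : i ≠ j) :
    0 ≤ S.lam i j * ‖S.disc.c i j‖ := by
  rcases eq_or_ne (S.disc.c i j) 0 with h | h
  · simp [h]
  · exact mul_nonneg ((maxWaveSpeed_nonneg _ _ _ _).trans (hlam i j hij h)) (norm_nonneg _)

theorem visc_nonneg (hlam : S.WaveSpeedBound) {i j : Fin N} (hij : i ≠ j) : 0 ≤ S.visc i j := by
  rw [visc_of_ne hij]
  exact (lam_mul_norm_nonneg hlam hij).trans (le_max_left _ _)

theorem visc_self (i : Fin N) :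
    S.visc i i = -∑ j ∈ S.disc.stencil i, if i = j then 0 else S.visc i j := by
  rw [visc, if_pos rfl, ← Finset.add_sum_erase _ _ (S.disc.mem_stencil i), if_pos rfl, zero_add]
  congr 1
  refine Finset.sum_congr rfl fun j hj => ?_
  rw [if_neg (Finset.ne_of_mem_erase hj).symm, visc_of_ne (Finset.ne_of_mem_erase hj).symm]

theorem abs_visc_self (hlam : S.WaveSpeedBound) (i : Fin N) :
    |S.visc i i| = ∑ j ∈ S.disc.stencil i, if i = j then 0 else S.visc i j := by
  rw [visc_self, abs_neg, abs_of_nonneg]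
  refine Finset.sum_nonneg fun j _ => ?_
  split_ifs with h
  · rfl
  · exact visc_nonneg hlam h

theorem norm_smul_normal (i j : Fin N) : ‖S.disc.c i j‖ • S.normal i j = S.disc.c i j := by
  rcases eq_or_ne (S.disc.c i j) 0 with h | h
  · simp [h]
  · rw [normal, smul_smul, mul_inv_cancel₀ (norm_ne_zero_iff.2 h), one_smul]

theorem norm_normal {i j : Fin N} (h : S.disc.c i j ≠ 0) : ‖S.normal i j‖ = 1 := by
  rw [normal, norm_smul, norm_inv, norm_norm, inv_mul_cancel₀ (norm_ne_zero_iff.2 h)]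

theorem inner_c_eq (i j : Fin N) (v : EuclideanSpace ℝ (Fin d)) :
    inner ℝ v (S.disc.c i j) = ‖S.disc.c i j‖ * inner ℝ v (S.normal i j) := by
  rw [← real_inner_smul_right, norm_smul_normal]

theorem lam_mul_norm_le_visc {i j : Fin N} (hij : i ≠ j) :
    S.lam i j * ‖S.disc.c i j‖ ≤ S.visc i j := by
  rw [visc_of_ne hij]
  exact le_max_left _ _

/-- The sign of the first weight in the depth of a bar state. -/
theorem visc_add_inner_pos (hg : 0 < S.g) (hlam : S.WaveSpeedBound) {i j : Fin N} (hij : i ≠ j)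
    (hH : 0 < S.Hstar i j) (hc : S.disc.c i j ≠ 0) :
    0 < S.visc i j + inner ℝ (S.V i) (S.disc.c i j) := by
  have h1 := pos_add_of_maxWaveSpeed_le hg hH (hlam i j hij hc)
  have h2 := mul_pos (norm_pos_iff.2 hc) h1
  rw [inner_c_eq]
  linarith [lam_mul_norm_le_visc (S := S) hij]

theorem visc_sub_inner_pos (hg : 0 < S.g) (hlam : S.WaveSpeedBound) {i j : Fin N} (hij : i ≠ j)
    (hH : 0 < S.Hstar j i) (hc : S.disc.c i j ≠ 0) :
    0 < S.visc i j - inner ℝ (S.V j) (S.disc.c i j) := by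
  have h1 := pos_sub_of_maxWaveSpeed_le hg hH (hlam i j hij hc)
  have h2 := mul_pos (norm_pos_iff.2 hc) h1
  rw [inner_c_eq]
  linarith [lam_mul_norm_le_visc (S := S) hij]

theorem visc_add_inner_nonneg (hg : 0 < S.g) (hlam : S.WaveSpeedBound) {i j : Fin N} (hij : i ≠ j)
    (hH : 0 < S.Hstar i j) : 0 ≤ S.visc i j + inner ℝ (S.V i) (S.disc.c i j) := by
  rcases eq_or_ne (S.disc.c i j) 0 with h | h
  · simpa [h] using visc_nonneg hlam hij
  · exact (visc_add_inner_pos hg hlam hij hH h).le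

theorem visc_sub_inner_nonneg (hg : 0 < S.g) (hlam : S.WaveSpeedBound) {i j : Fin N} (hij : i ≠ j)
    (hH : 0 < S.Hstar j i) : 0 ≤ S.visc i j - inner ℝ (S.V j) (S.disc.c i j) := by
  rcases eq_or_ne (S.disc.c i j) 0 with h | h
  · simpa [h] using visc_nonneg hlam hij
  · exact (visc_sub_inner_pos hg hlam hij hH h).le

theorem visc_relEntropy_ineq (hg : 0 < S.g) (hlam : S.WaveSpeedBound) {i j : Fin N} (hij : i ≠ j)
    (a : ℝ) (w : EuclideanSpace ℝ (Fin d)) :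
    0 ≤ S.visc i j * (relEntropy S.g a w (S.Hstar i j) (S.V i)
        + relEntropy S.g a w (S.Hstar j i) (S.V j))
      - (relFlux S.g a w (S.Hstar j i) (S.V j) (S.disc.c i j)
        - relFlux S.g a w (S.Hstar i j) (S.V i) (S.disc.c i j)) := by
  have hη := add_nonneg (relEntropy_nonneg (a := a) hg (S.Hstar_nonneg i j) w (S.V i))
    (relEntropy_nonneg (a := a) hg (S.Hstar_nonneg j i) w (S.V j))
  rcases eq_or_ne (S.disc.c i j) 0 with h | h
  · have := mul_nonneg (visc_nonneg hlam hij) hη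
    simpa [h, relFlux] using this
  · have key := riemann_relEntropy_ineq (a := a) hg (S.Hstar_nonneg i j) (S.Hstar_nonneg j i) w
      (S.V i) (S.V j) (S.normal i j) (norm_normal h) (hlam i j hij h)
    have h1 := mul_nonneg (norm_nonneg (S.disc.c i j)) key
    have h2 := mul_le_mul_of_nonneg_right (lam_mul_norm_le_visc (S := S) hij) hη
    rw [← norm_smul_normal (S := S) i j, relFlux_smul, relFlux_smul]
    linarith

/-- The part of the low-order flux that remains when the shift and the terms that cancel in the
sum over the stencil are split off. -/
noncomputable def barFlux (S : Step d N) (i j : Fin N) : State d :=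
  S.visc i j • (S.Ustar i j + S.Ustar j i - (2 : ℝ) • S.U i)
    - (physFlux S.g (S.Hstar j i) (S.V j) (S.disc.c i j)
      - physFlux S.g (S.Hstar i j) (S.V i) (S.disc.c i j))

theorem lowFlux_eq (i j : Fin N) :
    S.lowFlux i j = S.barFlux i j
      + (-2 * (S.visc i j + inner ℝ (S.V i) (S.disc.c i j))) • (S.Ustar i j - S.U i)
      - ((2 * inner ℝ (S.V i) (S.disc.c i j)) • S.U i
        + ((0 : ℝ), (S.g * (S.U i).1 ^ 2) • S.disc.c i j)) := by
  refine Prod.ext ?_ ?_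
  · simp [lowFlux, barFlux, physFlux, Ustar]
    ring
  · simp only [lowFlux, barFlux, physFlux, Ustar, Prod.snd_add, Prod.snd_sub, Prod.snd_neg,
      Prod.smul_snd]
    module

theorem sum_lowFlux (i : Fin N) :
    ∑ j ∈ S.disc.stencil i, S.lowFlux i j = ∑ j ∈ S.disc.stencil i, S.barFlux i j + S.shift i := by
  have h1 : ∑ j ∈ S.disc.stencil i, ((2 * inner ℝ (S.V i) (S.disc.c i j)) • S.U i
        + ((0 : ℝ), (S.g * (S.U i).1 ^ 2) • S.disc.c i j)) = 0 := by
    rw [Finset.sum_add_distrib, ← Finset.sum_smul, ← Finset.mul_sum, ← inner_sum, S.disc.sum_c,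
      inner_zero_right, mul_zero, zero_smul, zero_add]
    refine Prod.ext ?_ ?_
    · simp [Prod.fst_sum]
    · simp [Prod.snd_sum, ← Finset.smul_sum, S.disc.sum_c]
  rw [Finset.sum_congr rfl fun j _ => lowFlux_eq i j, Finset.sum_sub_distrib, h1, sub_zero,
    Finset.sum_add_distrib, shift]

theorem barFlux_self (hA : ∀ i, S.U i ∈ admissible d) (hreg : ∀ i, S.ε * S.hmax ≤ (S.U i).1)
    (i : Fin N) : S.barFlux i i = 0 := by
  rw [barFlux, Ustar_self hA hreg le_rfl, sub_self, two_smul, sub_self, smul_zero, sub_zero]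

theorem Eflat_Ustar_le (hg : 0 < S.g) (hA : ∀ i, S.U i ∈ admissible d)
    (hreg : ∀ i, S.ε * S.hmax ≤ (S.U i).1) (i j : Fin N) :
    Eflat S.g (S.Ustar i j) ≤ Eflat S.g (S.U i) := by
  rw [V_eq hA hreg i, Ustar, Eflat_mk_smul, Eflat_mk_smul]
  have := S.Hstar_nonneg i j
  have := Hstar_le hA i j
  gcongr

/-- The Riemann inequality gives this with the entropy of U_i^{j,*} in place of that of U_i.
Reconstruction lowers the depth and keeps the velocity, so it cannot raise the entropy. -/
theorem barFlux_entropy_le (hg : 0 < S.g) (hA : ∀ i, S.U i ∈ admissible d)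
    (hreg : ∀ i, S.ε * S.hmax ≤ (S.U i).1) (hlam : S.WaveSpeedBound) {i j : Fin N} (w : State d) :
    gradE S.g w (S.barFlux i j) +
        (inner ℝ (Fflat S.g (S.Ustar j i) - Fflat S.g (S.Ustar i j)) (S.disc.c i j)
        - S.visc i j * (Eflat S.g (S.Ustar j i) - Eflat S.g (S.Ustar i j))) ≤
      2 * (if i = j then 0 else S.visc i j) *
        relEntropy S.g w.1 (velocity w) (S.U i).1 (S.V i) := by
  split_ifs with hij
  · subst hij
    simp [barFlux_self hA hreg]
  · have key := visc_relEntropy_ineq hg hlam hij w.1 (velocity w)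
    have hE := mul_le_mul_of_nonneg_left (Eflat_Ustar_le hg hA hreg i j) (visc_nonneg hlam hij)
    simp only [relEntropy_velocity, relFlux_velocity, ← V_eq hA hreg] at key ⊢
    change 0 ≤ S.visc i j * (Eflat S.g (S.Ustar i j) - gradE S.g w (S.Ustar i j) + _
      + (Eflat S.g (S.Ustar j i) - gradE S.g w (S.Ustar j i) + _))
      - (inner ℝ (Fflat S.g (S.Ustar j i)) _ - _ - (inner ℝ (Fflat S.g (S.Ustar i j)) _ - _)) at key
    simp only [barFlux, map_sub, map_add, map_smul, smul_eq_mul, inner_sub_left]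
    linarith

theorem CFL.mul_visc_le {τ : ℝ} (h : S.CFL τ) (i : Fin N) :
    2 * |S.visc i i| * τ ≤ S.disc.m i := by
  linarith [h i]

/-- The entropy inequality with the gradient evaluated at the updated state. -/
theorem entropyBalance_le (hg : 0 < S.g) (hA : ∀ i, S.U i ∈ admissible d)
    (hreg : ∀ i, S.ε * S.hmax ≤ (S.U i).1) (hlam : S.WaveSpeedBound) (i : Fin N) {τ : ℝ}
    (hτ : 0 < τ) (hcfl : S.CFL τ) (hw : 0 < (S.update τ i).1) :
    S.entropyBalance τ i ≤ gradE S.g (S.update τ i) (S.shift i) := by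
  set w := S.update τ i with hwdef
  have hm := S.disc.m_pos i
  have hsum := Finset.sum_le_sum fun j (_ : j ∈ S.disc.stencil i) =>
    barFlux_entropy_le hg hA hreg hlam (i := i) (j := j) w
  rw [Finset.sum_add_distrib, ← Finset.sum_mul, ← Finset.mul_sum, ← abs_visc_self hlam,
    ← map_sum] at hsum
  have hη := relEntropy_nonneg (a := w.1) hg (le_of_lt (hA i)) (velocity w) (S.V i)
  -- The budget of relative entropy from the time difference covers the total cost of the bar
  -- fluxes.
  have hcfl' : 2 * |S.visc i i| ≤ S.disc.m i / τ := by
    rw [le_div_iff₀ hτ]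
    exact hcfl.mul_visc_le i
  have h1 := mul_le_mul_of_nonneg_right hcfl' hη
  have hEw : Eflat S.g w = gradE S.g w w - 1 / 2 * S.g * w.1 ^ 2 := by
    have h2 : w = (w.1, w.1 • velocity w) := by
      refine Prod.ext rfl ?_
      simp [velocity, smul_smul, hw.ne']
    have h3 := relEntropy_velocity S.g w w.1 (velocity w)
    rw [← h2] at h3
    simp only [relEntropy, sub_self, norm_zero] at h3
    linarith
  have hgw : S.disc.m i / τ * (gradE S.g w w - gradE S.g w (S.U i)) =
      gradE S.g w (∑ j ∈ S.disc.stencil i, S.barFlux i j) + gradE S.g w (S.shift i) := by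
    rw [← map_sub, ← map_add, ← sum_lowFlux]
    conv_lhs => rw [show w - S.U i = (τ / S.disc.m i) • ∑ j ∈ S.disc.stencil i, S.lowFlux i j by
      rw [hwdef, update, add_sub_cancel_left]]
    rw [map_smul, smul_eq_mul, ← mul_assoc, div_mul_div_cancel₀ hτ.ne', div_self hm.ne', one_mul]
  rw [relEntropy_velocity, ← V_eq hA hreg] at hη h1 hsum
  rw [entropyBalance, ← hwdef, hEw]
  linarith

end Step

end ShallowWater

/-! ### From the gradient at the update to the gradient at U_i. -/

namespace ShallowWater

variable {d N : ℕ}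

theorem waveCurve_lt_edgeSpeed {g h₀ : ℝ} (hg : 0 < g) (hh₀ : 0 < h₀) (h : ℝ) :
    waveCurve g h₀ h < edgeSpeed g h₀ h := by
  unfold waveCurve edgeSpeed
  split_ifs with hle
  · have h1 : 0 < √(g * h₀) := by positivity
    have h2 : √(g * h) ≤ √(g * h₀) := Real.sqrt_le_sqrt (by gcongr)
    linarith
  · push Not at hle
    have hp : 0 < h := hh₀.trans hle
    rw [show g * h * (h + h₀) / (2 * h₀) = h ^ 2 * (g * (h + h₀) / (2 * h * h₀)) by field_simp,
      Real.sqrt_mul (by positivity), Real.sqrt_sq hp.le]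
    have : 0 < √(g * (h + h₀) / (2 * h * h₀)) := by positivity
    gcongr
    linarith

/-- Otherwise the left edge would have speed ≥ 0 and the right edge speed ≤ 0, but the fan has
positive width because `edgeSpeed` exceeds `waveCurve`. -/
theorem maxWaveSpeed_pos {g hL hR : ℝ} (hg : 0 < g) (hhL : 0 ≤ hL) (hhR : 0 ≤ hR)
    (hwet : 0 < hL ∨ 0 < hR) (vL vR n : EuclideanSpace ℝ (Fin d)) :
    0 < maxWaveSpeed g ((hL, hL • vL) : State d) (hR, hR • vR) n := by
  by_contra! hneg
  have h1 := (neg_le_abs _).trans ((le_max_left _ _).trans hneg)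
  have h2 := (le_abs_self _).trans ((le_max_right _ _).trans hneg)
  rcases hhL.eq_or_lt' with rfl | hL0
  · have hR0 := hwet.resolve_left (lt_irrefl _)
    simp only [velocity_mk_smul hR0.ne', leftSpeed, rightSpeed, lt_irrefl, if_false,
      if_pos hR0] at h1 h2
    linarith [Real.sqrt_pos.2 (mul_pos hg hR0)]
  · rcases hhR.eq_or_lt' with rfl | hR0
    · simp only [velocity_mk_smul hL0.ne', leftSpeed, rightSpeed, lt_irrefl, if_false,
        if_pos hL0] at h1 h2
      linarith [Real.sqrt_pos.2 (mul_pos hg hL0)]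
    · simp only [velocity_mk_smul hL0.ne', velocity_mk_smul hR0.ne', leftSpeed, rightSpeed,
        if_pos hL0, if_pos hR0] at h1 h2
      obtain ⟨-, hm⟩ := middleDepth_spec hg hL0 hR0 (inner ℝ vL n) (inner ℝ vR n)
      set h := middleDepth g hL (inner ℝ vL n) hR (inner ℝ vR n)
      have h3 := waveCurve_lt_edgeSpeed hg hL0 h
      have h4 := waveCurve_lt_edgeSpeed hg hR0 h
      rcases hm with hm | ⟨hm, hvac⟩
      · linarith
      · rw [← hm] at hvac
        linarith

namespace Step

variable {S : Step d N}

theorem visc_pos (hg : 0 < S.g) (hA : ∀ i, S.U i ∈ admissible d) (hlam : S.WaveSpeedBound)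
    {i j : Fin N} (hij : i ≠ j) (hc : S.disc.c i j ≠ 0) : 0 < S.visc i j := by
  have h := maxWaveSpeed_pos hg (S.Hstar_nonneg i j) (S.Hstar_nonneg j i) (Hstar_pos_or hA i j)
    (S.V i) (S.V j) (S.normal i j)
  exact (mul_pos (h.trans_le (hlam i j hij hc)) (norm_pos_iff.2 hc)).trans_le
    (lam_mul_norm_le_visc hij)

theorem velocity_U (hA : ∀ i, S.U i ∈ admissible d) (hreg : ∀ i, S.ε * S.hmax ≤ (S.U i).1)
    (i : Fin N) : velocity (S.U i) = S.V i := by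
  rw [V_eq hA hreg i, velocity_mk_smul (ne_of_gt (hA i))]

/-- The depth component of the shift. -/
noncomputable def shiftDepth (S : Step d N) (i : Fin N) : ℝ :=
  ∑ j ∈ S.disc.stencil i,
    2 * (S.visc i j + inner ℝ (S.V i) (S.disc.c i j)) * ((S.U i).1 - S.Hstar i j)

theorem shift_eq (hA : ∀ i, S.U i ∈ admissible d) (hreg : ∀ i, S.ε * S.hmax ≤ (S.U i).1)
    (i : Fin N) : S.shift i = S.shiftDepth i • ((1 : ℝ), S.V i) := by
  rw [shift, shiftDepth, Finset.sum_smul]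
  refine Finset.sum_congr rfl fun j _ => ?_
  rw [V_eq hA hreg i, Ustar]
  refine Prod.ext ?_ ?_
  · simp
    ring
  · simp only [Prod.smul_snd, Prod.snd_sub]
    module

theorem gradE_shift (hA : ∀ i, S.U i ∈ admissible d) (hreg : ∀ i, S.ε * S.hmax ≤ (S.U i).1)
    (i : Fin N) (w : State d) :
    gradE S.g w (S.shift i) = S.shiftDepth i *
      (S.g * w.1 + 1 / 2 * ‖S.V i‖ ^ 2 - 1 / 2 * ‖velocity w - S.V i‖ ^ 2) := by
  rw [shift_eq hA hreg, map_smul, smul_eq_mul, gradE_apply, norm_sub_sq_real]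
  ring

theorem fderiv_shift (hA : ∀ i, S.U i ∈ admissible d) (hreg : ∀ i, S.ε * S.hmax ≤ (S.U i).1)
    (i : Fin N) :
    fderiv ℝ (Eflat S.g) (S.U i) (S.shift i) =
      S.shiftDepth i * (S.g * (S.U i).1 + 1 / 2 * ‖S.V i‖ ^ 2) := by
  rw [(hasFDerivAt_Eflat S.g (hA i)).fderiv, gradE_shift hA hreg, velocity_U hA hreg]
  simp

/-- The rate of change of the depth in the low-order update. -/
noncomputable def depthRate (S : Step d N) (i : Fin N) : ℝ :=
  (S.disc.m i)⁻¹ * (∑ j ∈ S.disc.stencil i, S.lowFlux i j).1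

theorem update_fst (τ : ℝ) (i : Fin N) :
    (S.update τ i).1 = (S.U i).1 + τ * S.depthRate i := by
  simp only [update, depthRate, Prod.fst_add, Prod.smul_fst, smul_eq_mul]
  ring

theorem entropyBalance_le_fderiv_add (hg : 0 < S.g) (hA : ∀ i, S.U i ∈ admissible d)
    (hreg : ∀ i, S.ε * S.hmax ≤ (S.U i).1) (hlam : S.WaveSpeedBound) (i : Fin N) {τ : ℝ}
    (hτ : 0 < τ) (hcfl : S.CFL τ) (hw : 0 < (S.update τ i).1) :
    S.entropyBalance τ i ≤ fderiv ℝ (Eflat S.g) (S.U i) (S.shift i)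
      + S.shiftDepth i * S.g * S.depthRate i * τ
      - 1 / 2 * S.shiftDepth i * ‖velocity (S.update τ i) - S.V i‖ ^ 2 := by
  refine (entropyBalance_le hg hA hreg hlam i hτ hcfl hw).trans_eq ?_
  rw [gradE_shift hA hreg, fderiv_shift hA hreg, update_fst]
  ring

/-- The rate of change, up to the factor `m_i`, of `Q - H V_i` in the low-order update. -/
noncomputable def velocityRate (S : Step d N) (i : Fin N) : EuclideanSpace ℝ (Fin d) :=
  (∑ j ∈ S.disc.stencil i, S.lowFlux i j).2 - (∑ j ∈ S.disc.stencil i, S.lowFlux i j).1 • S.V i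

theorem velocity_update_sub (hA : ∀ i, S.U i ∈ admissible d)
    (hreg : ∀ i, S.ε * S.hmax ≤ (S.U i).1) (i : Fin N) {τ : ℝ} (hw : 0 < (S.update τ i).1) :
    velocity (S.update τ i) - S.V i =
      (τ / S.disc.m i / (S.update τ i).1) • S.velocityRate i := by
  have h1 : (S.update τ i).1 • (velocity (S.update τ i) - S.V i) =
      (τ / S.disc.m i) • S.velocityRate i := by
    rw [smul_sub, velocity, smul_inv_smul₀ hw.ne']
    simp only [update, velocityRate, Prod.fst_add, Prod.snd_add, Prod.smul_fst, Prod.smul_snd,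
      smul_eq_mul]
    have h2 : (S.U i).2 = (S.U i).1 • S.V i := congrArg Prod.snd (V_eq hA hreg i)
    rw [h2]
    module
  rw [div_eq_inv_mul, mul_smul, ← h1, inv_smul_smul₀ hw.ne']

/-- Needed because the CFL condition at i does not bound τ when d_ii = 0. Then every off-diagonal
d_ij and c_ij in the stencil vanishes, so only the shift, parallel to (1, V_i), is left. -/
theorem velocityRate_eq_zero (hg : 0 < S.g) (hA : ∀ i, S.U i ∈ admissible d)
    (hreg : ∀ i, S.ε * S.hmax ≤ (S.U i).1) (hlam : S.WaveSpeedBound) {i : Fin N}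
    (hd : S.visc i i = 0) : S.velocityRate i = 0 := by
  have hbar : ∑ j ∈ S.disc.stencil i, S.barFlux i j = 0 := by
    refine Finset.sum_eq_zero fun j hj => ?_
    rcases eq_or_ne i j with rfl | hij
    · exact barFlux_self hA hreg _
    · have h0 := abs_visc_self hlam i
      rw [hd, abs_zero, eq_comm, Finset.sum_eq_zero_iff_of_nonneg] at h0
      · have hv := h0 j hj
        rw [if_neg hij] at hv
        have hc : S.disc.c i j = 0 := by
          by_contra hc
          exact (visc_pos hg hA hlam hij hc).ne' hv
        simp [barFlux, hv, hc, physFlux]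
      · intro k _
        split_ifs with h
        · rfl
        · exact visc_nonneg hlam h
  rw [velocityRate, sum_lowFlux, hbar, zero_add, shift_eq hA hreg]
  simp

theorem exists_entropyBalance_bound (hg : 0 < S.g) (hA : ∀ i, S.U i ∈ admissible d)
    (hreg : ∀ i, S.ε * S.hmax ≤ (S.U i).1) (hlam : S.WaveSpeedBound) (i : Fin N) {δ : ℝ}
    (hδ : 0 < δ) :
    ∃ C : ℝ, ∀ τ : ℝ, 0 < τ → S.CFL τ → δ ≤ (S.update τ i).1 →
      S.entropyBalance τ i ≤ fderiv ℝ (Eflat S.g) (S.U i) (S.shift i) + C * τ := by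
  have hm := S.disc.m_pos i
  -- The largest τ allowed by the CFL condition at i, used to trade τ² for T τ. For d_ii = 0 it
  -- takes the value 0, which is harmless since the velocity is then unchanged.
  set T : ℝ := S.disc.m i / (2 * |S.visc i i|)
  set K : ℝ := (1 / S.disc.m i / δ) ^ 2 * ‖S.velocityRate i‖ ^ 2
  refine ⟨S.shiftDepth i * S.g * S.depthRate i + 1 / 2 * |S.shiftDepth i| * (T * K),
    fun τ hτ hcfl hδτ => ?_⟩
  have hw := hδ.trans_le hδτ
  have key := entropyBalance_le_fderiv_add hg hA hreg hlam i hτ hcfl hw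
  have hsq : ‖velocity (S.update τ i) - S.V i‖ ^ 2 ≤ τ * (T * K) := by
    rcases eq_or_ne (S.visc i i) 0 with hd | hd
    · rw [velocity_update_sub hA hreg i hw]
      simp [K, velocityRate_eq_zero hg hA hreg hlam hd]
    · have hd' : 0 < 2 * |S.visc i i| := by positivity
      have hT : τ ≤ T := by
        rw [le_div_iff₀ hd']
        exact hcfl i
      calc ‖velocity (S.update τ i) - S.V i‖ ^ 2
          = (τ * (1 / S.disc.m i / (S.update τ i).1)) ^ 2 * ‖S.velocityRate i‖ ^ 2 := by
            rw [velocity_update_sub hA hreg i hw, norm_smul, mul_pow, Real.norm_eq_abs, sq_abs]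
            congr 2
            ring
        _ ≤ (τ * (1 / S.disc.m i / δ)) ^ 2 * ‖S.velocityRate i‖ ^ 2 := by gcongr
        _ = τ * (τ * K) := by ring
        _ ≤ τ * (T * K) := by gcongr
  have h1 : -(S.shiftDepth i) * ‖velocity (S.update τ i) - S.V i‖ ^ 2 ≤
      |S.shiftDepth i| * (τ * (T * K)) :=
    (mul_le_mul_of_nonneg_right (neg_le_abs _) (sq_nonneg _)).trans
      (mul_le_mul_of_nonneg_left hsq (abs_nonneg _))
  linarith

/-! ### Sign of the shift and positivity of the depth. -/

theorem shiftDepth_nonneg (hg : 0 < S.g) (hA : ∀ i, S.U i ∈ admissible d)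
    (hlam : S.WaveSpeedBound) {i : Fin N}
    (hdry : ∀ j ∈ S.disc.stencil i, S.Hstar i j = 0 →
      0 ≤ S.visc i j + inner ℝ (S.V i) (S.disc.c i j)) : 0 ≤ S.shiftDepth i := by
  refine Finset.sum_nonneg fun j hj => ?_
  rcases eq_or_ne i j with rfl | hij
  · simp [Hstar_of_Z_le hA le_rfl]
  · have h1 : 0 ≤ S.visc i j + inner ℝ (S.V i) (S.disc.c i j) := by
      rcases (S.Hstar_nonneg i j).eq_or_lt' with h | h
      · exact hdry j hj h
      · exact visc_add_inner_nonneg hg hlam hij h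
    have h2 := sub_nonneg.2 (Hstar_le hA i j)
    positivity

/-- The depth of a bar state, multiplied by `2 d_ij`. -/
theorem barFlux_fst (i j : Fin N) :
    (S.barFlux i j).1 + 2 * S.visc i j * (S.U i).1 =
      (S.visc i j + inner ℝ (S.V i) (S.disc.c i j)) * S.Hstar i j
        + (S.visc i j - inner ℝ (S.V j) (S.disc.c i j)) * S.Hstar j i := by
  simp [barFlux, physFlux, Ustar]
  ring

theorem barFlux_fst_nonneg (hg : 0 < S.g) (hlam : S.WaveSpeedBound) {i j : Fin N} (hij : i ≠ j) :
    0 ≤ (S.barFlux i j).1 + 2 * S.visc i j * (S.U i).1 := by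
  rw [barFlux_fst]
  refine add_nonneg ?_ ?_
  · rcases (S.Hstar_nonneg i j).eq_or_lt' with h | h
    · simp [h]
    · exact mul_nonneg (visc_add_inner_nonneg hg hlam hij h) h.le
  · rcases (S.Hstar_nonneg j i).eq_or_lt' with h | h
    · simp [h]
    · exact mul_nonneg (visc_sub_inner_nonneg hg hlam hij h) h.le

/-- The node with the higher bathymetry keeps its full depth, so one of the two terms has positive
depth, and its weight is strictly positive. -/
theorem barFlux_fst_pos (hg : 0 < S.g) (hA : ∀ i, S.U i ∈ admissible d) (hlam : S.WaveSpeedBound)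
    {i j : Fin N} (hij : i ≠ j) (hd : 0 < S.visc i j) :
    0 < (S.barFlux i j).1 + 2 * S.visc i j * (S.U i).1 := by
  refine lt_of_le_of_ne (barFlux_fst_nonneg hg hlam hij) fun h0 => ?_
  rw [barFlux_fst] at h0
  have hl : 0 ≤ (S.visc i j + inner ℝ (S.V i) (S.disc.c i j)) * S.Hstar i j ∧
      (0 < S.Hstar i j → 0 < (S.visc i j + inner ℝ (S.V i) (S.disc.c i j)) * S.Hstar i j) := by
    rcases (S.Hstar_nonneg i j).eq_or_lt' with h | h
    · simp [h]
    · rcases eq_or_ne (S.disc.c i j) 0 with hc | hc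
      · simp [hc, mul_pos hd h, (mul_pos hd h).le]
      · have := mul_pos (visc_add_inner_pos hg hlam hij h hc) h
        exact ⟨this.le, fun _ => this⟩
  have hr : 0 ≤ (S.visc i j - inner ℝ (S.V j) (S.disc.c i j)) * S.Hstar j i ∧
      (0 < S.Hstar j i → 0 < (S.visc i j - inner ℝ (S.V j) (S.disc.c i j)) * S.Hstar j i) := by
    rcases (S.Hstar_nonneg j i).eq_or_lt' with h | h
    · simp [h]
    · rcases eq_or_ne (S.disc.c i j) 0 with hc | hc
      · simp [hc, mul_pos hd h, (mul_pos hd h).le]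
      · have := mul_pos (visc_sub_inner_pos hg hlam hij h hc) h
        exact ⟨this.le, fun _ => this⟩
  rcases Hstar_pos_or hA i j with h | h
  · linarith [hl.2 h, hr.1]
  · linarith [hr.2 h, hl.1]

/-- Positivity of the depth when the shift does not remove water. -/
theorem update_mem_admissible (hg : 0 < S.g) (hA : ∀ i, S.U i ∈ admissible d)
    (hreg : ∀ i, S.ε * S.hmax ≤ (S.U i).1) (hlam : S.WaveSpeedBound) {i : Fin N}
    (hshift : 0 ≤ S.shiftDepth i) {τ : ℝ} (hτ : 0 < τ) (hcfl : S.CFL τ) :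
    S.update τ i ∈ admissible d := by
  have hm := S.disc.m_pos i
  have hH : 0 < (S.U i).1 := hA i
  set D : Fin N → ℝ := fun j => if i = j then 0 else S.visc i j with hD
  set P : Fin N → ℝ := fun j => (S.barFlux i j).1 + 2 * D j * (S.U i).1 with hP
  have hP0 : ∀ j ∈ S.disc.stencil i, 0 ≤ P j := fun j _ => by
    rcases eq_or_ne i j with rfl | hij
    · simp [hP, hD, barFlux_self hA hreg]
    · simpa [hP, hD, hij] using barFlux_fst_nonneg hg hlam hij
  have hsumP : ∑ j ∈ S.disc.stencil i, P j =
      (∑ j ∈ S.disc.stencil i, S.barFlux i j).1 + 2 * |S.visc i i| * (S.U i).1 := by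
    rw [abs_visc_self hlam, Prod.fst_sum, Finset.mul_sum, Finset.sum_mul, ← Finset.sum_add_distrib]
  have hdecomp : S.disc.m i * (S.update τ i).1 =
      (S.disc.m i - 2 * |S.visc i i| * τ) * (S.U i).1
        + τ * (∑ j ∈ S.disc.stencil i, P j) + τ * S.shiftDepth i := by
    rw [update_fst, depthRate, sum_lowFlux, shift_eq hA hreg, hsumP]
    simp only [Prod.fst_add, Prod.smul_fst, smul_eq_mul, mul_one]
    field_simp
    ring
  have h1 : 0 ≤ τ * S.shiftDepth i := mul_nonneg hτ.le hshift
  have h2 : 0 ≤ τ * ∑ j ∈ S.disc.stencil i, P j := mul_nonneg hτ.le (Finset.sum_nonneg hP0)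
  have h3 := hcfl.mul_visc_le i
  refine pos_of_mul_pos_right ?_ hm.le
  rw [hdecomp]
  -- At equality in the CFL condition the weight of the old depth is zero, and positivity must come
  -- from some bar state with d_ij > 0.
  rcases h3.lt_or_eq with h3 | h3
  · have := mul_pos (sub_pos.2 h3) hH
    linarith
  · have hd : 0 < |S.visc i i| := by
      refine (abs_nonneg _).lt_of_ne fun h0 => ?_
      rw [← h0] at h3
      linarith
    rw [abs_visc_self hlam] at hd
    obtain ⟨j, hj, hj0⟩ := Finset.exists_lt_of_sum_lt (f := fun _ => (0 : ℝ)) (by simpa using hd)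
    have hij : i ≠ j := by
      rintro rfl
      simp at hj0
    rw [if_neg hij] at hj0
    have hPj : 0 < P j := by
      simpa [hP, hD, hij] using barFlux_fst_pos hg hA hlam hij hj0
    have := mul_pos hτ (Finset.sum_pos' hP0 ⟨j, hj, hPj⟩)
    rw [h3, sub_self, zero_mul]
    linarith

end Step

end ShallowWater

theorem proposition3p5 {d N : ℕ} (S : ShallowWater.Step d N)
    (hg : 0 < S.g)
    (hA : ∀ i, S.U i ∈ ShallowWater.admissible d)
    (hreg : ∀ i, S.ε * S.hmax ≤ (S.U i).1)
    (hlam : S.WaveSpeedBound)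
    (i : Fin N) :
    -- the remainder is `O(τ)`, uniformly as long as the updated depth stays away from zero
    (∀ δ : ℝ, 0 < δ → ∃ C : ℝ, ∀ τ : ℝ, 0 < τ → S.CFL τ → δ ≤ (S.update τ i).1 →
      S.entropyBalance τ i ≤
        fderiv ℝ (ShallowWater.Eflat S.g) (S.U i) (S.shift i) + C * τ) ∧
    -- it is `O(τ)` uniformly on the whole CFL range when `d_ij + V_i · c_ij ≥ 0`
    ((∀ j ∈ S.disc.stencil i, S.Hstar i j = 0 →
        0 ≤ S.visc i j + inner ℝ (S.V i) (S.disc.c i j)) →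
      ∃ C : ℝ, ∀ τ : ℝ, 0 < τ → S.CFL τ →
        S.update τ i ∈ ShallowWater.admissible d ∧
        S.entropyBalance τ i ≤
          fderiv ℝ (ShallowWater.Eflat S.g) (S.U i) (S.shift i) + C * τ) ∧
    -- flat topography
    ((∀ j ∈ S.disc.stencil i, S.Z j = S.Z i) →
      ∀ τ : ℝ, 0 < τ → S.CFL τ →
        S.update τ i ∈ ShallowWater.admissible d ∧
        S.entropyBalanceFlat τ i ≤ 0) := by
  refine ⟨fun δ hδ => ShallowWater.Step.exists_entropyBalance_bound hg hA hreg hlam i hδ,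
    fun hdry => ?_, fun hflat τ hτ hcfl => ?_⟩
  · have hb := ShallowWater.Step.shiftDepth_nonneg hg hA hlam hdry
    refine ⟨S.shiftDepth i * S.g * S.depthRate i, fun τ hτ hcfl => ?_⟩
    have hw := ShallowWater.Step.update_mem_admissible hg hA hreg hlam hb hτ hcfl
    refine ⟨hw, ?_⟩
    have key := ShallowWater.Step.entropyBalance_le_fderiv_add hg hA hreg hlam i hτ hcfl hw
    -- With b ≥ 0 the squared velocity change only helps, so no lower bound on the depth is needed.
    have := mul_nonneg hb (sq_nonneg ‖ShallowWater.velocity (S.update τ i) - S.V i‖)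
    linarith
  · have hb : S.shiftDepth i = 0 := Finset.sum_eq_zero fun j hj => by
      rw [ShallowWater.Step.Hstar_of_Z_le hA (hflat j hj).le, sub_self, mul_zero]
    have hw := ShallowWater.Step.update_mem_admissible hg hA hreg hlam hb.ge hτ hcfl
    refine ⟨hw, ?_⟩
    have key := ShallowWater.Step.entropyBalance_le hg hA hreg hlam i hτ hcfl hw
    rw [ShallowWater.Step.gradE_shift hA hreg, hb, zero_mul] at key
    refine le_of_eq_of_le ?_ key
    rw [ShallowWater.Step.entropyBalanceFlat, ShallowWater.Step.entropyBalance]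
    congr 1
    refine Finset.sum_congr rfl fun j hj => ?_
    rw [ShallowWater.Step.Ustar_self hA hreg (hflat j hj).le,
      ShallowWater.Step.Ustar_self hA hreg (hflat j hj).ge]
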